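/- Let $n\ge 3000$, and let $\eta_0,\dots,\eta_K>0$ be any finite list of learning rates. Then there exist a dimension $d$, a closed convex set $\mathcal X\subseteq\mathbb R^d$ containing $0$, a random variable $S$, and a loss $f(x;S)$ that is convex in $x\in\mathcal X$ and almost surely $1$-Lipschitz in $x$ (Euclidean norm), with finite expectation $F(x)=\mathbb E[f(x;S)]$ and $F^\star=\inf_{x\in\mathcal X}F(x)=F(0)$ (so the origin is a minimizer), such that the following holds. Let $S_1,\dots,S_{2n}$ be i.i.d. copies of $S$, write $f_i(x)=f(x;S_i)$, and regard $f_1,\dots,f_n$ as the validation set and $f_{n+1},\dots,f_{2n}$ as the training set. Let $\nabla f(x;s)$ denote an arbitrary fixed choice of subgradients. For $R>0$ let $\mathrm{AdaSGD}(R)=\frac1n\sum_{t=1}^n u_t$ be the output of adaptive SGD with learning rate $R$, where $u_1=0$ and $$u_{t+1}=\mathrm{proj}_R\left(u_t-R\,\frac{\nabla f_{n+t}(u_t)}{\sqrt{\sum_{j=1}^t\|\nabla f_{n+j}(u_j)\|_2^2}}\right),\qquad \mathrm{proj}_R(v)=\operatorname*{argmin}_{u\in\mathcal X:\ \|u\|_2\le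 R}\|u-v\|_2$$ (with the convention $0/0=0$). Put $x_k=\mathrm{AdaSGD}(\eta_k)$ for $k=0,\dots,K$. Then, with probability at least $1/1000$, every index $\hat k\in\operatorname*{argmin}_{0\le k\le K}\frac1n\sum_{i=1}^n f_i(x_k)$ that standard model selection (minimizing the validation loss) may return satisfies $$F(x_{\hat k})-F^\star\ \ge\ \frac{1}{288\sqrt n}\,\max_{0\le k\le K}\eta_k .$$ -/

import Mathlib

open MeasureTheory ProbabilityTheory

/-- A stochastic convex optimization problem on a closed convex domain `X ⊆ ℝ^d`: minimize
`F x = 𝔼[f(x; S)]` over `X`, where `S` is a random sample with law `law` and every `f(·; s)` is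
convex on `X`. The domain contains the origin, which is the reference (starting) model. -/
structure StochConvexProblem (d : ℕ) (𝒮 : Type*) [MeasurableSpace 𝒮] where
  domain : Set (EuclideanSpace ℝ (Fin d))
  isClosed_domain : IsClosed domain
  convex_domain : Convex ℝ domain
  zero_mem : (0 : EuclideanSpace ℝ (Fin d)) ∈ domain
  law : Measure 𝒮
  isProb : IsProbabilityMeasure law
  loss : EuclideanSpace ℝ (Fin d) → 𝒮 → ℝ
  convexOn_loss : ∀ s, ConvexOn ℝ domain (fun x => loss x s)
  integrable_loss : ∀ x ∈ domain, Integrable (loss x) law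
  bddBelow_risk : BddBelow ((fun x => ∫ s, loss x s ∂law) '' domain)

/-- The set of minimizers of `‖u - v‖₂` over `u ∈ X` with `‖u‖₂ ≤ R`. -/
def nearestPoints {d : ℕ} (X : Set (EuclideanSpace ℝ (Fin d))) (R : ℝ)
    (v : EuclideanSpace ℝ (Fin d)) : Set (EuclideanSpace ℝ (Fin d)) :=
  {u | (u ∈ X ∧ ‖u‖ ≤ R) ∧ ∀ w ∈ X, ‖w‖ ≤ R → ‖u - v‖ ≤ ‖w - v‖}

/-- The projection `proj_R v = argmin_{u ∈ X, ‖u‖₂ ≤ R} ‖u - v‖₂`. For `X` closed and convex with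
`0 ∈ X` and `R ≥ 0` it is the unique nearest point
(`projBall_mem`, `eq_projBall_of_mem`). -/
noncomputable def projBall {d : ℕ} (X : Set (EuclideanSpace ℝ (Fin d))) (R : ℝ)
    (v : EuclideanSpace ℝ (Fin d)) : EuclideanSpace ℝ (Fin d) :=
  Classical.epsilon (fun u => u ∈ nearestPoints X R v)

theorem projBall_mem {d : ℕ} {X : Set (EuclideanSpace ℝ (Fin d))} (hX : IsClosed X)
    (h0 : 0 ∈ X) {R : ℝ} (hR : 0 ≤ R) (v : EuclideanSpace ℝ (Fin d)) :
    projBall X R v ∈ nearestPoints X R v := by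
  apply Classical.epsilon_spec (p := fun u => u ∈ nearestPoints X R v)
  have hc : IsCompact (X ∩ Metric.closedBall 0 R) :=
    (isCompact_closedBall _ _).inter_left hX
  obtain ⟨u, hu, hmin⟩ := hc.exists_isMinOn ⟨0, h0, by simpa using hR⟩
    (f := fun u => ‖u - v‖) (by fun_prop)
  refine ⟨u, ⟨hu.1, by simpa using hu.2⟩, fun w hw hwR => hmin ⟨hw, by simpa using hwR⟩⟩

theorem eq_projBall_of_mem {d : ℕ} {X : Set (EuclideanSpace ℝ (Fin d))} (hX : IsClosed X)
    (hconv : Convex ℝ X) (h0 : 0 ∈ X) {R : ℝ} (hR : 0 ≤ R) {u v : EuclideanSpace ℝ (Fin d)}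
    (hu : u ∈ nearestPoints X R v) : u = projBall X R v := by
  obtain ⟨⟨hpX, hpR⟩, hp⟩ := projBall_mem hX h0 hR v
  obtain ⟨⟨huX, huR⟩, hu⟩ := hu
  set p := projBall X R v
  have hball : Convex ℝ (X ∩ Metric.closedBall 0 R) := hconv.inter (convex_closedBall _ _)
  have hm : (1 / 2 : ℝ) • u + (1 / 2 : ℝ) • p ∈ X ∩ Metric.closedBall 0 R :=
    hball ⟨huX, by simpa using huR⟩ ⟨hpX, by simpa using hpR⟩ (by norm_num) (by norm_num)
      (by norm_num)
  have h1 := hu _ hm.1 (by simpa using hm.2)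
  have h2 := hu p hpX hpR
  have h3 := hp u huX huR
  have e : (1 / 2 : ℝ) • u + (1 / 2 : ℝ) • p - v = (1 / 2 : ℝ) • ((u - v) + (p - v)) := by
    module
  rw [e, norm_smul, Real.norm_of_nonneg (by norm_num)] at h1
  have par := parallelogram_law_with_norm ℝ (u - v) (p - v)
  have e2 : (u - v) - (p - v) = u - p := by abel
  rw [e2] at par
  have h4 : ‖u - p‖ * ‖u - p‖ ≤ 0 := by
    nlinarith [norm_nonneg (u - v), norm_nonneg (p - v), norm_nonneg ((u - v) + (p - v))]
  have h5 : ‖u - p‖ = 0 := by nlinarith [norm_nonneg (u - p)]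
  exact sub_eq_zero.mp (norm_eq_zero.mp h5)

namespace StochConvexProblem

variable {d : ℕ} {𝒮 : Type*} [MeasurableSpace 𝒮] (P : StochConvexProblem d 𝒮)

/-- The population risk `F x = 𝔼[f(x; S)]`. -/
noncomputable def risk (x : EuclideanSpace ℝ (Fin d)) : ℝ := ∫ s, P.loss x s ∂P.law

/-- `F⋆ = inf_{x ∈ X} F x`. -/
noncomputable def optRisk : ℝ := sInf (P.risk '' P.domain)

/-- `f` is `L`-Lipschitz: almost surely `f(·; S)` is `L`-Lipschitz on the domain. -/
def IsLipschitz (L : ℝ) : Prop :=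
  ∀ᵐ s ∂P.law, ∀ x ∈ P.domain, ∀ y ∈ P.domain, |P.loss x s - P.loss y s| ≤ L * ‖x - y‖

/-- `v` is a subgradient at `x` of the convex function `f(·; s)` on the domain. -/
def IsSubgradient (x : EuclideanSpace ℝ (Fin d)) (s : 𝒮) (v : EuclideanSpace ℝ (Fin d)) : Prop :=
  ∀ y ∈ P.domain, P.loss x s + inner ℝ v (y - x) ≤ P.loss y s

/-- `g` is a choice of subgradients: `g x s` plays the role of `∇f(x; s)`, which stands for an
arbitrary subgradient of `f(·; s)` at `x`. -/
def IsSubgradientOracle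
    (g : EuclideanSpace ℝ (Fin d) → 𝒮 → EuclideanSpace ℝ (Fin d)) : Prop :=
  ∀ᵐ s ∂P.law, ∀ x ∈ P.domain, P.IsSubgradient x s (g x s)

/-- The state `(u_{t+1}, ∑_{j=1}^t ‖∇f(u_j; z_j)‖²)` of adaptive SGD with learning rate `R`
after processing the training samples `z 1, …, z t`, started from `u_1 = 0`. If all gradients
seen so far vanish, the iterate does not move (`0 / 0 = 0`). -/
noncomputable def adaSGDState (g : EuclideanSpace ℝ (Fin d) → 𝒮 → EuclideanSpace ℝ (Fin d))
    (R : ℝ) (z : ℕ → 𝒮) : ℕ → EuclideanSpace ℝ (Fin d) × ℝ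
  | 0 => (0, 0)
  | t + 1 =>
    let u := (adaSGDState g R z t).1
    let v := g u (z (t + 1))
    let G := (adaSGDState g R z t).2 + ‖v‖ ^ 2
    (projBall P.domain R (u - (R / √G) • v), G)

/-- The iterate `u_t` of adaptive SGD, for `t ≥ 1`. -/
noncomputable def adaSGDIter (g : EuclideanSpace ℝ (Fin d) → 𝒮 → EuclideanSpace ℝ (Fin d))
    (R : ℝ) (z : ℕ → 𝒮) (t : ℕ) : EuclideanSpace ℝ (Fin d) :=
  (P.adaSGDState g R z (t - 1)).1

/-- The output `(1/n) ∑_{t=1}^n u_t` of adaptive SGD on the training samples `z 1, …, z n`. -/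
noncomputable def adaSGD (g : EuclideanSpace ℝ (Fin d) → 𝒮 → EuclideanSpace ℝ (Fin d))
    (R : ℝ) (n : ℕ) (z : ℕ → 𝒮) : EuclideanSpace ℝ (Fin d) :=
  (1 / (n : ℝ)) • ∑ t ∈ Finset.Icc 1 n, P.adaSGDIter g R z t

theorem adaSGDIter_one (g : EuclideanSpace ℝ (Fin d) → 𝒮 → EuclideanSpace ℝ (Fin d))
    (R : ℝ) (z : ℕ → 𝒮) : P.adaSGDIter g R z 1 = 0 := rfl

theorem adaSGDState_snd (g : EuclideanSpace ℝ (Fin d) → 𝒮 → EuclideanSpace ℝ (Fin d))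
    (R : ℝ) (z : ℕ → 𝒮) (t : ℕ) : (P.adaSGDState g R z t).2 =
      ∑ j ∈ Finset.Icc 1 t, ‖g (P.adaSGDIter g R z j) (z j)‖ ^ 2 := by
  induction t with
  | zero => rfl
  | succ t ih =>
    rw [Finset.sum_Icc_succ_top (by omega), ← ih]
    rfl

/-- The defining recursion of adaptive SGD. -/
theorem adaSGDIter_succ (g : EuclideanSpace ℝ (Fin d) → 𝒮 → EuclideanSpace ℝ (Fin d))
    (R : ℝ) (z : ℕ → 𝒮) {t : ℕ} (ht : 1 ≤ t) : P.adaSGDIter g R z (t + 1) =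
      projBall P.domain R (P.adaSGDIter g R z t -
        (R / √(∑ j ∈ Finset.Icc 1 t, ‖g (P.adaSGDIter g R z j) (z j)‖ ^ 2)) •
          g (P.adaSGDIter g R z t) (z t)) := by
  obtain ⟨t, rfl⟩ : ∃ m, t = m + 1 := ⟨t - 1, by omega⟩
  rw [← P.adaSGDState_snd]
  rfl

/-- The validation loss `(1/n) ∑_{i=1}^n f(x; z_i)`. -/
noncomputable def empRisk (n : ℕ) (z : ℕ → 𝒮) (x : EuclideanSpace ℝ (Fin d)) : ℝ :=
  (1 / (n : ℝ)) * ∑ i ∈ Finset.Icc 1 n, P.loss x (z i)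

/-- The indices that standard model selection may return: those of the models in the list `x`
that minimize the loss on the validation samples `z 1, …, z n`. -/
def greedySelection (n : ℕ) (z : ℕ → 𝒮) {ι : Type*} (x : ι → EuclideanSpace ℝ (Fin d)) : Set ι :=
  {k | ∀ j, P.empRisk n z (x k) ≤ P.empRisk n z (x j)}

end StochConvexProblem

/-- `Q` holds with probability at least `p`: it holds throughout a measurable event of probability
at least `p` (so no measurability of `Q` is presupposed). -/
def WithProbAtLeast {Ω : Type*} [MeasurableSpace Ω] (μ : Measure Ω) (p : ℝ) (Q : Ω → Prop) : Prop :=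
  ∃ A : Set Ω, MeasurableSet A ∧ p ≤ μ.real A ∧ ∀ ω ∈ A, Q ω

/-! The hard instance is one-dimensional: the loss `(1 - ε) s x + ε |x|` with a fair sign `s` and `ε
= 1 / (28 √n)`, so the risk is `ε |x|`. The loss is positively homogeneous, and away from `0` its
subgradients see only the sign of `x`. Hence the output with rate `R` is `R` times the output `x`
with rate `1` (`adaSGD_eq_smul`), and validation losses scale likewise. If the validation loss of
`x` is negative, selection must take the largest rate and pays `ε |x|` times that rate.

It remains to get `|x| ≥ 28 / 288` and a negative validation loss together. Up to an error of order
`ε √n`, at most `0.096`, `x` is the time average of a walk with steps `±1 / √t` clamped to `[-1, 1]`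
(`abs_adaSGD_sub_mean_clampWalk_le`). Its positions have second moment at least `1 / 4` from time
`4` on and are positively correlated at comparable times, so the average is of constant order with
constant probability (`le_bitMean_sum_shiftedWalk_sq`). The validation signs are independent of the
walk; their sum is of order `√n` with constant probability, and both signs are equally likely. When
its sign is opposite to that of `x`, the linear term beats `ε |x|` (`le_bitMean_overfitEvent`,
`adaSGD_of_overfit`). -/

open scoped BigOperators

/-! ### Averages over uniformly random bits -/

/-- The sign `±1` encoded by a bit. -/
noncomputable def bitSign (b : Bool) : ℝ := if b then 1 else -1

theorem bitSign_not (b : Bool) : bitSign (!b) = -bitSign b := by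
  cases b <;> simp [bitSign]

theorem bitSign_sq (b : Bool) : bitSign b ^ 2 = 1 := by
  cases b <;> simp [bitSign]

theorem abs_bitSign (b : Bool) : |bitSign b| = 1 := by
  cases b <;> simp [bitSign]

/-- Extension of a bit string indexed by `s` to all of `ℕ` by `false`. -/
def extendBits (s : Finset ℕ) (x : s → Bool) : ℕ → Bool :=
  fun i => if h : i ∈ s then x ⟨i, h⟩ else false

/-- Flip the bits with index in `T`. -/
def flipOn (T : Finset ℕ) (z : ℕ → Bool) : ℕ → Bool :=
  fun i => if i ∈ T then !z i else z i

theorem flipOn_of_mem {T : Finset ℕ} {i : ℕ} (h : i ∈ T) (z : ℕ → Bool) :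
    flipOn T z i = !z i := by simp [flipOn, h]

theorem flipOn_of_notMem {T : Finset ℕ} {i : ℕ} (h : i ∉ T) (z : ℕ → Bool) :
    flipOn T z i = z i := by simp [flipOn, h]

/-- The mean of `F` over uniformly random bits with index in `s`, all other bits being `false`. -/
noncomputable def bitMean (s : Finset ℕ) (F : (ℕ → Bool) → ℝ) : ℝ :=
  𝔼 x : s → Bool, F (extendBits s x)

section bitMean

variable {s : Finset ℕ} {F G : (ℕ → Bool) → ℝ}

theorem bitMean_mono (h : ∀ z, F z ≤ G z) : bitMean s F ≤ bitMean s G :=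
  Finset.expect_le_expect fun _ _ => h _

theorem bitMean_add : bitMean s (fun z => F z + G z) = bitMean s F + bitMean s G :=
  Finset.expect_add_distrib ..

theorem bitMean_sub : bitMean s (fun z => F z - G z) = bitMean s F - bitMean s G :=
  Finset.expect_sub_distrib ..

theorem bitMean_const_mul (c : ℝ) : bitMean s (fun z => c * F z) = c * bitMean s F :=
  (Finset.mul_expect ..).symm

theorem bitMean_const (c : ℝ) : bitMean s (fun _ => c) = c :=
  Fintype.expect_const c

theorem bitMean_nonneg (h : ∀ z, 0 ≤ F z) : 0 ≤ bitMean s F :=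
  (bitMean_const (s := s) 0).symm.le.trans (bitMean_mono h)

theorem bitMean_sum {ι : Type*} (T : Finset ι) (F : ι → (ℕ → Bool) → ℝ) :
    bitMean s (fun z => ∑ i ∈ T, F i z) = ∑ i ∈ T, bitMean s (F i) :=
  Finset.expect_sum_comm ..

theorem bitMean_flipOn {T : Finset ℕ} (hT : T ⊆ s) (F : (ℕ → Bool) → ℝ) :
    bitMean s (fun z => F (flipOn T z)) = bitMean s F := by
  have hinv : Function.Involutive
      (fun (x : s → Bool) (i : s) => if (i : ℕ) ∈ T then !x i else x i) := by
    intro x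
    funext i
    by_cases h : (i : ℕ) ∈ T <;> simp [h]
  refine Fintype.expect_equiv hinv.toPerm _ _ fun x => ?_
  refine congrArg F (funext fun i => ?_)
  by_cases h : i ∈ T
  · simp [flipOn, extendBits, h, hT h]
  · simp [flipOn, extendBits, h]

/-- Averaging over a block flip first. -/
theorem bitMean_eq_flipOn_average {T : Finset ℕ} (hT : T ⊆ s) (F : (ℕ → Bool) → ℝ) :
    bitMean s F = bitMean s (fun z => 1 / 2 * (F z + F (flipOn T z))) := by
  rw [bitMean_const_mul, bitMean_add, bitMean_flipOn hT]
  ring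

/-- Second moment of a sum of random signs, weighted by an independent factor. -/
theorem bitMean_mul_sum_sq (k : ℕ) (hk : Finset.Icc 1 k ⊆ s)
    (hG : ∀ i ∈ Finset.Icc 1 k, ∀ z, G (flipOn {i} z) = G z) :
    bitMean s (fun z => G z * (∑ i ∈ Finset.Icc 1 k, bitSign (z i)) ^ 2) = k * bitMean s G := by
  induction k with
  | zero => simp [bitMean_const]
  | succ k ih =>
    have hmem : k + 1 ∈ Finset.Icc 1 (k + 1) := by simp
    have hsub : Finset.Icc 1 k ⊆ Finset.Icc 1 (k + 1) := Finset.Icc_subset_Icc_right (by omega)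
    rw [bitMean_eq_flipOn_average (T := {k + 1}) (by simpa using hk hmem)]
    have key : ∀ z, 1 / 2 * (G z * (∑ i ∈ Finset.Icc 1 (k + 1), bitSign (z i)) ^ 2 +
        G (flipOn {k + 1} z) *
          (∑ i ∈ Finset.Icc 1 (k + 1), bitSign (flipOn {k + 1} z i)) ^ 2) =
        G z * (∑ i ∈ Finset.Icc 1 k, bitSign (z i)) ^ 2 + G z := by
      intro z
      have e : ∑ i ∈ Finset.Icc 1 k, bitSign (flipOn {k + 1} z i) =
          ∑ i ∈ Finset.Icc 1 k, bitSign (z i) := by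
        refine Finset.sum_congr rfl fun i hi => ?_
        rw [flipOn_of_notMem]
        simp only [Finset.mem_Icc, Finset.mem_singleton] at hi ⊢
        omega
      rw [hG _ hmem, Finset.sum_Icc_succ_top (by omega), Finset.sum_Icc_succ_top (by omega), e,
        flipOn_of_mem (by simp), bitSign_not]
      linear_combination G z * bitSign_sq (z (k + 1))
    simp only [key]
    rw [bitMean_add, ih (hsub.trans hk) fun i hi => hG i (hsub hi)]
    push_cast
    ring

/-- Fourth moment of a sum of random signs, weighted by an independent factor. -/
theorem bitMean_mul_sum_pow_four (k : ℕ) (hk : Finset.Icc 1 k ⊆ s)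
    (hG : ∀ i ∈ Finset.Icc 1 k, ∀ z, G (flipOn {i} z) = G z) :
    bitMean s (fun z => G z * (∑ i ∈ Finset.Icc 1 k, bitSign (z i)) ^ 4) =
      (3 * k ^ 2 - 2 * k) * bitMean s G := by
  induction k with
  | zero => simp [bitMean_const]
  | succ k ih =>
    have hmem : k + 1 ∈ Finset.Icc 1 (k + 1) := by simp
    have hsub : Finset.Icc 1 k ⊆ Finset.Icc 1 (k + 1) := Finset.Icc_subset_Icc_right (by omega)
    rw [bitMean_eq_flipOn_average (T := {k + 1}) (by simpa using hk hmem)]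
    have key : ∀ z, 1 / 2 * (G z * (∑ i ∈ Finset.Icc 1 (k + 1), bitSign (z i)) ^ 4 +
        G (flipOn {k + 1} z) *
          (∑ i ∈ Finset.Icc 1 (k + 1), bitSign (flipOn {k + 1} z i)) ^ 4) =
        G z * (∑ i ∈ Finset.Icc 1 k, bitSign (z i)) ^ 4 +
          (6 * (G z * (∑ i ∈ Finset.Icc 1 k, bitSign (z i)) ^ 2) + G z) := by
      intro z
      have e : ∑ i ∈ Finset.Icc 1 k, bitSign (flipOn {k + 1} z i) =
          ∑ i ∈ Finset.Icc 1 k, bitSign (z i) := by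
        refine Finset.sum_congr rfl fun i hi => ?_
        rw [flipOn_of_notMem]
        simp only [Finset.mem_Icc, Finset.mem_singleton] at hi ⊢
        omega
      rw [hG _ hmem, Finset.sum_Icc_succ_top (by omega), Finset.sum_Icc_succ_top (by omega), e,
        flipOn_of_mem (by simp), bitSign_not]
      linear_combination G z * (6 * (∑ i ∈ Finset.Icc 1 k, bitSign (z i)) ^ 2 +
        bitSign (z (k + 1)) ^ 2 + 1) * bitSign_sq (z (k + 1))
    simp only [key]
    have hG' : ∀ i ∈ Finset.Icc 1 k, ∀ z, G (flipOn {i} z) = G z := fun i hi => hG i (hsub hi)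
    rw [bitMean_add, bitMean_add, bitMean_const_mul, ih (hsub.trans hk) hG',
      bitMean_mul_sum_sq k (hsub.trans hk) hG']
    push_cast
    ring

end bitMean

/-! ### Clamping and the cosine test function -/

/-- The projection of the real line onto `[-1, 1]`. -/
noncomputable def clampUnit (y : ℝ) : ℝ := max (-1) (min 1 y)

theorem abs_clampUnit_le (y : ℝ) : |clampUnit y| ≤ 1 :=
  abs_le.2 ⟨le_max_left _ _, max_le (by norm_num) (min_le_left _ _)⟩

theorem clampUnit_of_abs_le {y : ℝ} (h : |y| ≤ 1) : clampUnit y = y := by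
  rw [clampUnit, min_eq_right (abs_le.1 h).2, max_eq_right (abs_le.1 h).1]

theorem clampUnit_of_one_le {y : ℝ} (h : 1 ≤ y) : clampUnit y = 1 := by
  rw [clampUnit, min_eq_left h, max_eq_right (by norm_num)]

theorem clampUnit_neg (y : ℝ) : clampUnit (-y) = -clampUnit y := by
  unfold clampUnit
  rcases le_total y 1 with h | h <;> rcases le_total (-1) y with h' | h' <;>
    simp [min_def, max_def] <;> split_ifs <;> linarith

theorem monotone_clampUnit : Monotone clampUnit :=
  fun _ _ h => max_le_max le_rfl (min_le_min le_rfl h)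

theorem abs_clampUnit_sub_le (x y : ℝ) : |clampUnit x - clampUnit y| ≤ |x - y| := by
  refine (abs_max_sub_max_le_max _ _ _ _).trans (max_le (by simp) ?_)
  exact (abs_min_sub_min_le_max _ _ _ _).trans (max_le (by simp) le_rfl)

theorem clampUnit_sub_sq_le {c : ℝ} (hc : |c| ≤ 1) (y : ℝ) :
    (clampUnit y - c) ^ 2 ≤ (y - c) ^ 2 := by
  have := abs_clampUnit_sub_le y c
  rw [clampUnit_of_abs_le hc] at this
  exact sq_le_sq.2 this

theorem abs_clampUnit_sub_self_le {c : ℝ} (hc : |c| ≤ 1) (y : ℝ) :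
    |clampUnit y - y| ≤ |c - y| := by
  rw [abs_le] at hc
  rcases le_total y 1 with h | h
  · rcases le_total (-1) y with h' | h'
    · simp [clampUnit_of_abs_le (abs_le.2 ⟨h', h⟩)]
    · rw [clampUnit, min_eq_right h, max_eq_left h', abs_of_nonneg (by linarith),
        abs_of_nonneg (by linarith)]
      linarith
  · rw [clampUnit_of_one_le h, abs_of_nonpos (by linarith), abs_of_nonpos (by linarith)]
    linarith

/-- Points outside `[-1, 1]` are clamped to `±1`, where `cos (π y)` attains its minimum `-1`. -/
theorem cos_pi_mul_clampUnit_le (y : ℝ) :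
    Real.cos (Real.pi * clampUnit y) ≤ Real.cos (Real.pi * y) := by
  rcases le_total 1 |y| with h | h
  · have e : Real.cos (Real.pi * clampUnit y) = -1 := by
      rcases le_abs.1 h with h | h
      · simp [clampUnit_of_one_le h]
      · have := clampUnit_of_one_le h
        rw [clampUnit_neg] at this
        rw [neg_eq_iff_eq_neg.1 this]
        simp
    exact e.le.trans (Real.neg_one_le_cos _)
  · rw [clampUnit_of_abs_le h]

/-- The two sides are tangent at `|y| = 1 / 2`. Shifting the cosine to a sine there leaves `sin u ≥
u - u³ / 6` on one side and `sin u ≤ u` on the other. -/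
theorem quarter_sub_cos_div_pi_le_sq {y : ℝ} (hy : |y| ≤ 1) :
    1 / 4 - Real.cos (Real.pi * y) / Real.pi ≤ y ^ 2 := by
  wlog h : 0 ≤ y generalizing y
  · have := this (y := -y) (by simpa using hy) (by linarith)
    simpa using this
  have hy1 : y ≤ 1 := (le_abs_self y).trans hy
  have hpi := Real.pi_gt_three
  have hpi' := Real.pi_lt_d2
  have hcos : Real.cos (Real.pi * y) = Real.sin (Real.pi * (1 / 2 - y)) := by
    rw [← Real.sin_pi_div_two_sub]
    congr 1
    ring
  rw [hcos]
  suffices 1 / 4 - y ^ 2 ≤ Real.sin (Real.pi * (1 / 2 - y)) / Real.pi by linarith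
  rw [le_div_iff₀ Real.pi_pos]
  rcases le_total y (1 / 2) with hh | hh
  · have h1 := Real.sin_ge_sub_cube (x := Real.pi * (1 / 2 - y)) (by nlinarith)
    refine le_trans ?_ h1
    have hu : 0 ≤ 1 / 2 - y := by linarith
    have hp2 : Real.pi ^ 2 ≤ 10 := by nlinarith
    have h2 : Real.pi ^ 2 * (1 / 2 - y) ≤ 6 := by nlinarith
    have h3 : 0 ≤ Real.pi * (1 / 2 - y) ^ 2 * (6 - Real.pi ^ 2 * (1 / 2 - y)) := by
      have := Real.pi_pos
      have : 0 ≤ 6 - Real.pi ^ 2 * (1 / 2 - y) := by linarith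
      positivity
    nlinarith
  · have h1 := Real.sin_le (x := Real.pi * (y - 1 / 2)) (by nlinarith)
    have e : Real.sin (Real.pi * (1 / 2 - y)) = -Real.sin (Real.pi * (y - 1 / 2)) := by
      rw [← Real.sin_neg]
      congr 1
      ring
    rw [e]
    nlinarith [mul_nonneg Real.pi_pos.le (sq_nonneg (y - 1 / 2))]

/-! ### The clamped walk and its second moments -/

/-- The random walk with signs `-z 1, -z 2, …` and step sizes `1 / √t`, started from `0` and
clamped to `[-1, 1]`. -/
noncomputable def clampWalk (z : ℕ → Bool) : ℕ → ℝ
  | 0 => 0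
  | t + 1 => clampUnit (clampWalk z t - bitSign (z (t + 1)) / √((t : ℝ) + 1))

theorem abs_clampWalk_le (z : ℕ → Bool) (t : ℕ) : |clampWalk z t| ≤ 1 := by
  cases t with
  | zero => simp [clampWalk]
  | succ t => exact abs_clampUnit_le _

theorem clampWalk_congr {z z' : ℕ → Bool} {t : ℕ} (h : ∀ i ∈ Finset.Icc 1 t, z i = z' i) :
    clampWalk z t = clampWalk z' t := by
  induction t with
  | zero => rfl
  | succ t ih =>
    rw [clampWalk, clampWalk, ih fun i hi => h i (Finset.Icc_subset_Icc_right (by omega) hi),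
      h (t + 1) (by simp)]

/-- The clamped walk driven by the bits after position `n`. -/
noncomputable def shiftedWalk (n : ℕ) (z : ℕ → Bool) (t : ℕ) : ℝ := clampWalk (fun i => z (n + i)) t

theorem shiftedWalk_flipOn {n t : ℕ} {T : Finset ℕ} (h : ∀ i ∈ Finset.Icc 1 t, n + i ∉ T)
    (z : ℕ → Bool) : shiftedWalk n (flipOn T z) t = shiftedWalk n z t :=
  clampWalk_congr fun i hi => flipOn_of_notMem (h i hi) z

section moments

variable {s : Finset ℕ} {n M : ℕ}

/-- One step of the Markov chain: the bit driving it is fair given everything else. The second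
argument of `Φ` carries quantities from the past. -/
theorem bitMean_shiftedWalk_succ {t : ℕ} (ht : n + t + 1 ∈ s) (Φ : ℝ → (ℕ → Bool) → ℝ)
    (hΦ : ∀ y z, Φ y (flipOn {n + t + 1} z) = Φ y z) :
    bitMean s (fun z => Φ (shiftedWalk n z (t + 1)) z) =
      bitMean s (fun z => 1 / 2 * (Φ (clampUnit (shiftedWalk n z t + 1 / √((t : ℝ) + 1))) z +
        Φ (clampUnit (shiftedWalk n z t - 1 / √((t : ℝ) + 1))) z)) := by
  rw [bitMean_eq_flipOn_average (T := {n + t + 1}) (by simpa using ht)]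
  congr 1
  funext z
  have e1 (z) : shiftedWalk n z (t + 1) =
    clampUnit (shiftedWalk n z t - bitSign (z (n + t + 1)) / √((t : ℝ) + 1)) := rfl
  rw [hΦ, e1, e1, shiftedWalk_flipOn (by intro i; simp; omega), flipOn_of_mem (by simp)]
  cases z (n + t + 1) <;> simp [bitSign, sub_eq_add_neg, neg_div, add_comm]

/-- `cos (π y)` is an eigenfunction of averaging over `y ± a`, with eigenvalue `cos (π a)`, and
clamping only lowers it. -/
theorem bitMean_cos_shiftedWalk_nonpos (hs : ∀ i < M, n + i + 1 ∈ s) {t : ℕ} (h4 : 4 ≤ t)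
    (ht : t ≤ M) : bitMean s (fun z => Real.cos (Real.pi * shiftedWalk n z t)) ≤ 0 := by
  have step (t : ℕ) (ht : t < M) :
      bitMean s (fun z => Real.cos (Real.pi * shiftedWalk n z (t + 1))) ≤
        Real.cos (Real.pi * (1 / √((t : ℝ) + 1))) *
          bitMean s (fun z => Real.cos (Real.pi * shiftedWalk n z t)) := by
    rw [bitMean_shiftedWalk_succ (hs t ht) (fun y _ => Real.cos (Real.pi * y)) (by simp),
      ← bitMean_const_mul]
    refine bitMean_mono fun z => ?_
    have h1 := cos_pi_mul_clampUnit_le (shiftedWalk n z t + 1 / √((t : ℝ) + 1))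
    have h2 := cos_pi_mul_clampUnit_le (shiftedWalk n z t - 1 / √((t : ℝ) + 1))
    rw [mul_add, Real.cos_add] at h1
    rw [mul_sub, Real.cos_sub] at h2
    linarith
  induction t, h4 using Nat.le_induction with
  | base =>
    -- The fourth step has size `1 / √4 = 1 / 2`, so its eigenvalue `cos (π / 2)` vanishes; all
    -- later eigenvalues are nonnegative.
    refine (step 3 (by omega)).trans (le_of_eq ?_)
    have : √(((3 : ℕ) : ℝ) + 1) = 2 := by
      rw [Real.sqrt_eq_iff_mul_self_eq] <;> norm_num
    rw [this, mul_one_div, Real.cos_pi_div_two, zero_mul]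
  | succ t h4 ih =>
    refine (step t (by omega)).trans (mul_nonpos_of_nonneg_of_nonpos ?_ (ih (by omega)))
    have hsq : 2 ≤ √((t : ℝ) + 1) := by
      apply Real.le_sqrt_of_sq_le
      have : (4 : ℝ) ≤ t := by exact_mod_cast h4
      linarith
    have h1 : 1 / √((t : ℝ) + 1) ≤ 1 / 2 := one_div_le_one_div_of_le (by norm_num) hsq
    have h0 : 0 ≤ 1 / √((t : ℝ) + 1) := by positivity
    apply Real.cos_nonneg_of_neg_pi_div_two_le_of_le <;> nlinarith [Real.pi_pos]

theorem quarter_le_bitMean_shiftedWalk_sq (hs : ∀ i < M, n + i + 1 ∈ s) {t : ℕ} (h4 : 4 ≤ t)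
    (ht : t ≤ M) : 1 / 4 ≤ bitMean s (fun z => shiftedWalk n z t ^ 2) := by
  have h := bitMean_mono (s := s) fun z =>
    quarter_sub_cos_div_pi_le_sq (abs_clampWalk_le (fun i => z (n + i)) t)
  have h2 := bitMean_cos_shiftedWalk_nonpos hs h4 ht
  simp only [div_eq_inv_mul _ Real.pi] at h
  rw [bitMean_sub, bitMean_const, bitMean_const_mul] at h
  have h3 := mul_nonpos_of_nonneg_of_nonpos (inv_nonneg.2 Real.pi_pos.le) h2
  unfold shiftedWalk at *
  linarith

/-- Clamping does not increase the distance to a point of `[-1, 1]`, so each step adds at most its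
squared size. -/
theorem bitMean_shiftedWalk_sub_sq_le (hs : ∀ i < M, n + i + 1 ∈ s) {t j : ℕ} (htj : t ≤ j)
    (hj : j ≤ M) : bitMean s (fun z => (shiftedWalk n z j - shiftedWalk n z t) ^ 2) ≤
      ∑ i ∈ Finset.Ico t j, 1 / ((i : ℝ) + 1) := by
  induction j, htj using Nat.le_induction with
  | base => simp [bitMean_const]
  | succ j htj ih =>
    rw [Finset.sum_Ico_succ_top htj,
      bitMean_shiftedWalk_succ (hs j hj) (fun y z => (y - shiftedWalk n z t) ^ 2) (by
        intro y z
        rw [shiftedWalk_flipOn]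
        simp only [Finset.mem_Icc, Finset.mem_singleton]
        omega)]
    refine le_trans ?_ (add_le_add_left (ih (by omega)) _)
    rw [← bitMean_const (s := s) (1 / ((j : ℝ) + 1)), ← bitMean_add]
    refine bitMean_mono fun z => ?_
    have hc := abs_clampWalk_le (fun i => z (n + i)) t
    have h1 := clampUnit_sub_sq_le hc (shiftedWalk n z j + 1 / √((j : ℝ) + 1))
    have h2 := clampUnit_sub_sq_le hc (shiftedWalk n z j - 1 / √((j : ℝ) + 1))
    have h3 : (1 / √((j : ℝ) + 1)) ^ 2 = 1 / ((j : ℝ) + 1) := by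
      rw [div_pow, one_pow, Real.sq_sqrt (by positivity)]
    change 1 / 2 * ((_ - clampWalk _ t) ^ 2 + (_ - clampWalk _ t) ^ 2) ≤ (_ - clampWalk _ t) ^ 2 + _
    nlinarith

/-- Used with `h = id` for nonnegative correlations. The general `h` makes the induction close: the
transition operator of the chain preserves odd monotone functions. -/
theorem bitMean_odd_monotone_mul_nonneg (hs : ∀ i < M, n + i + 1 ∈ s) {h : ℝ → ℝ}
    (hodd : ∀ y, h (-y) = -h y) (hmono : Monotone h) {t j : ℕ} (htj : t ≤ j) (hj : j ≤ M) :
    0 ≤ bitMean s (fun z => h (shiftedWalk n z j) * shiftedWalk n z t) := by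
  induction j, htj using Nat.le_induction generalizing h with
  | base =>
    refine bitMean_nonneg fun z => ?_
    have h0 : h 0 = 0 := by
      have := hodd 0
      rw [neg_zero] at this
      linarith
    rcases le_total 0 (shiftedWalk n z t) with hy | hy
    · exact mul_nonneg (h0 ▸ hmono hy) hy
    · exact mul_nonneg_of_nonpos_of_nonpos (h0 ▸ hmono hy) hy
  | succ j htj ih =>
    rw [bitMean_shiftedWalk_succ (hs j hj) (fun y z => h y * shiftedWalk n z t) (by
        intro y z
        rw [shiftedWalk_flipOn]
        simp only [Finset.mem_Icc, Finset.mem_singleton]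
        omega)]
    have := ih (h := fun y => 1 / 2 * (h (clampUnit (y + 1 / √((j : ℝ) + 1))) +
      h (clampUnit (y - 1 / √((j : ℝ) + 1))))) ?_ ?_ (by omega)
    · convert this using 3
      ring
    · intro y
      have e1 : -y + 1 / √((j : ℝ) + 1) = -(y - 1 / √((j : ℝ) + 1)) := by ring
      have e2 : -y - 1 / √((j : ℝ) + 1) = -(y + 1 / √((j : ℝ) + 1)) := by ring
      simp only [e1, e2, clampUnit_neg, hodd]
      ring
    · intro x y hxy
      have h1 := hmono (monotone_clampUnit (add_le_add_left hxy (1 / √((j : ℝ) + 1))))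
      have h2 := hmono (monotone_clampUnit (sub_le_sub_right hxy (1 / √((j : ℝ) + 1))))
      simp only
      linarith

/-- Exchanging the sums gives `∑ i ∈ Ico m j, (1 - m / (i + 1))`; the bound is Jensen's inequality
for this concave summand, checked here by increments. -/
theorem sum_sum_Ico_one_div_le {m j : ℕ} (h : m ≤ j) :
    ∑ t ∈ Finset.Ico m j, ∑ i ∈ Finset.Ico t j, 1 / ((i : ℝ) + 1) ≤
      (j - m) * (j - m + 1) / (m + j + 1) := by
  induction j, h using Nat.le_induction with
  | base => simp
  | succ j h ih =>
    have e : ∑ t ∈ Finset.Ico m (j + 1), ∑ i ∈ Finset.Ico t (j + 1), 1 / ((i : ℝ) + 1) =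
        ∑ t ∈ Finset.Ico m j, ∑ i ∈ Finset.Ico t j, 1 / ((i : ℝ) + 1) +
          (j + 1 - m) * (1 / ((j : ℝ) + 1)) := by
      rw [Finset.sum_Ico_succ_top h, Finset.sum_congr rfl fun t ht =>
        Finset.sum_Ico_succ_top (Finset.mem_Ico.1 ht).2.le _, Finset.sum_add_distrib]
      simp [Nat.cast_sub h]
      ring
    rw [e]
    refine (add_le_add_left ih _).trans ?_
    obtain ⟨N, rfl⟩ := Nat.exists_eq_add_of_le h
    push_cast
    have hm : (0 : ℝ) ≤ m := Nat.cast_nonneg m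
    have hN : (0 : ℝ) ≤ N := Nat.cast_nonneg N
    have e2 : ((m : ℝ) + (N + m - m + 1)) = m + N + 1 := by ring
    rw [← sub_nonneg]
    have : ((m : ℝ) + N + 1 - m) * (m + N + 1 - m + 1) / (m + (m + N + 1) + 1) -
        ((m + N - m) * (m + N - m + 1) / (m + (m + N) + 1) + (m + N + 1 - m) * (1 / (m + N + 1))) =
        (N + 1) * N * m / ((2 * m + N + 2) * (2 * m + N + 1) * (m + N + 1)) := by
      field_simp
      ring
    rw [this]
    positivity

theorem sub_five_div_ten_le_bitMean_mul_sum (hs : ∀ i < M, n + i + 1 ∈ s) {j : ℕ} (hj : j ≤ M) :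
    ((j : ℝ) - 5) / 10 ≤
      2 * bitMean s (fun z => shiftedWalk n z j * ∑ t ∈ Finset.range j, shiftedWalk n z t) := by
  simp only [Finset.mul_sum]
  rw [bitMean_sum]
  have hnonneg : ∀ t ∈ Finset.range j,
      0 ≤ bitMean s (fun z => shiftedWalk n z j * shiftedWalk n z t) := fun t ht =>
    bitMean_odd_monotone_mul_nonneg hs (h := id) (by simp) monotone_id
      (Finset.mem_range.1 ht).le hj
  rcases Nat.lt_or_ge j 6 with h6 | h6
  · have h1 := Finset.sum_nonneg hnonneg
    have : (j : ℝ) ≤ 5 := by exact_mod_cast (by omega : j ≤ 5)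
    linarith
  -- Only the last `N ≈ 2 j / 5` times are used, a near-optimal share; the earlier correlations are
  -- dropped as nonnegative. From `j ≥ 6` on, `m ≥ 4`, as the bound `1 / 4` needs.
  obtain ⟨N, m, hjm, hN1, hN2⟩ : ∃ N m, j = m + N ∧ 5 * N ≤ 2 * j ∧ 2 * j ≤ 5 * N + 4 :=
    ⟨2 * j / 5, j - 2 * j / 5, by omega, by omega, by omega⟩
  have hsub : ∑ t ∈ Finset.Ico m j, bitMean s (fun z => shiftedWalk n z j * shiftedWalk n z t) ≤
      ∑ t ∈ Finset.range j, bitMean s (fun z => shiftedWalk n z j * shiftedWalk n z t) := by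
    rw [Finset.range_eq_Ico]
    refine Finset.sum_le_sum_of_subset_of_nonneg (Finset.Ico_subset_Ico_left (by omega)) ?_
    intro t ht _
    exact hnonneg t (by simpa using ht)
  have hterm : ∀ t ∈ Finset.Ico m j, 1 / 4 - 1 / 2 * ∑ i ∈ Finset.Ico t j, 1 / ((i : ℝ) + 1) ≤
      bitMean s (fun z => shiftedWalk n z j * shiftedWalk n z t) := by
    intro t ht
    rw [Finset.mem_Ico] at ht
    have h1 := bitMean_shiftedWalk_sub_sq_le hs ht.2.le hj
    have h2 := quarter_le_bitMean_shiftedWalk_sq hs (by omega : 4 ≤ j) hj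
    have h3 := quarter_le_bitMean_shiftedWalk_sq hs (by omega : 4 ≤ t) (by omega)
    have e : bitMean s (fun z => (shiftedWalk n z j - shiftedWalk n z t) ^ 2) =
        bitMean s (fun z => shiftedWalk n z j ^ 2) + bitMean s (fun z => shiftedWalk n z t ^ 2) -
          2 * bitMean s (fun z => shiftedWalk n z j * shiftedWalk n z t) := by
      rw [← bitMean_const_mul, ← bitMean_add, ← bitMean_sub]
      congr 1
      funext z
      ring
    linarith
  have h1 := (Finset.sum_le_sum hterm).trans hsub
  rw [Finset.sum_sub_distrib, ← Finset.mul_sum] at h1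
  have h2 := sum_sum_Ico_one_div_le (by omega : m ≤ j)
  simp only [Finset.sum_const, Nat.card_Ico, nsmul_eq_mul] at h1
  rw [Nat.cast_sub (by omega)] at h1
  have hNr : (j : ℝ) - m = N := by
    rw [hjm]
    push_cast
    ring
  have hN2r : 2 * (j : ℝ) ≤ 5 * N + 4 := by exact_mod_cast hN2
  have hN1r : 5 * (N : ℝ) ≤ 2 * j := by exact_mod_cast hN1
  have hN0 : (0 : ℝ) ≤ N := Nat.cast_nonneg N
  rw [hNr] at h1 h2
  have h3 : (N : ℝ) * (N + 1) / (m + j + 1) ≤ N / 4 + 3 / 10 := by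
    rw [div_le_iff₀ (by positivity)]
    nlinarith
  linarith

/-- The time average of the clamped walk has second moment about `1 / 20`. -/
theorem le_bitMean_sum_shiftedWalk_sq (hs : ∀ i < M, n + i + 1 ∈ s) {k : ℕ} (hk : k ≤ M + 1) :
    (k : ℝ) ^ 2 / 20 - 11 / 20 * k ≤
      bitMean s (fun z => (∑ t ∈ Finset.range k, shiftedWalk n z t) ^ 2) := by
  induction k with
  | zero => simp [bitMean_const]
  | succ k ih =>
    have h1 := sub_five_div_ten_le_bitMean_mul_sum hs (by omega : k ≤ M)
    have h2 := ih (by omega)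
    -- The diagonal term is discarded; the cross terms `(k - 5) / 10` add up to `k² / 20 - 11 k /
    -- 20`.
    refine le_trans ?_ (bitMean_mono (F := fun z => (∑ t ∈ Finset.range k, shiftedWalk n z t) ^ 2 +
      2 * (shiftedWalk n z k * ∑ t ∈ Finset.range k, shiftedWalk n z t)) fun z => ?_)
    · rw [bitMean_add, bitMean_const_mul]
      push_cast
      linarith
    · rw [Finset.sum_range_succ]
      nlinarith [sq_nonneg (shiftedWalk n z k)]

end moments

/-! ### Probability of the overfitting event -/

/-- The event that the time average of the shifted walk is bounded away from `0`, while the sum of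
the first `n` signs is at least of order `√n` and has the opposite sign. -/
def OverfitEvent (n : ℕ) (z : ℕ → Bool) : Prop :=
  39 / 200 ≤ |1 / (n : ℝ) * ∑ t ∈ Finset.range n, shiftedWalk n z t| ∧
    √(n : ℝ) / 20 ≤ |∑ i ∈ Finset.Icc 1 n, bitSign (z i)| ∧
    (1 / (n : ℝ) * ∑ t ∈ Finset.range n, shiftedWalk n z t) *
      ∑ i ∈ Finset.Icc 1 n, bitSign (z i) < 0

theorem abs_mean_clampWalk_le {n : ℕ} (hn : 0 < n) (z : ℕ → Bool) :
    |1 / (n : ℝ) * ∑ t ∈ Finset.range n, clampWalk z t| ≤ 1 := by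
  have hn' : (0 : ℝ) < n := by exact_mod_cast hn
  rw [abs_mul, abs_of_pos (by positivity : 0 < 1 / (n : ℝ)), one_div_mul_eq_div, div_le_one hn']
  refine (Finset.abs_sum_le_sum_abs _ _).trans ?_
  refine (Finset.sum_le_sum fun t _ => abs_clampWalk_le z t).trans (by simp)

open Classical in
-- Since the average `y` lies in `[-1, 1]`, the indicator of `|y| ≥ c` is at least `y² - c²`.
theorem le_bitMean_mean_walk_large (n : ℕ) (hn : 3000 ≤ n) :
    117 / 10000 ≤ bitMean (Finset.Icc 1 (2 * n)) (fun z =>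
      if 39 / 200 ≤ |1 / (n : ℝ) * ∑ t ∈ Finset.range n, shiftedWalk n z t| then 1 else 0) := by
  have hn' : (3000 : ℝ) ≤ n := by exact_mod_cast hn
  have h := le_bitMean_sum_shiftedWalk_sq (s := Finset.Icc 1 (2 * n)) (n := n) (M := n)
    (by intro i hi; simp; omega) (k := n) (by omega)
  refine le_trans ?_ (bitMean_mono (F := fun z =>
    (1 / (n : ℝ)) ^ 2 * (∑ t ∈ Finset.range n, shiftedWalk n z t) ^ 2 - (39 / 200) ^ 2) fun z => ?_)
  · rw [bitMean_sub, bitMean_const_mul, bitMean_const]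
    have h1 := mul_le_mul_of_nonneg_left h (sq_nonneg (1 / (n : ℝ)))
    have h2 : (1 / (n : ℝ)) ^ 2 * ((n : ℝ) ^ 2 / 20 - 11 / 20 * n) = 1 / 20 - 11 / 20 * (1 / n) := by
      field_simp
    have h3 : 1 / (n : ℝ) ≤ 1 / 3000 := one_div_le_one_div_of_le (by norm_num) hn'
    rw [h2] at h1
    linarith
  · rw [← mul_pow]
    have h1 := abs_mean_clampWalk_le (by omega : 0 < n) (fun i => z (n + i))
    change |1 / (n : ℝ) * ∑ t ∈ Finset.range n, shiftedWalk n z t| ≤ 1 at h1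
    generalize 1 / (n : ℝ) * ∑ t ∈ Finset.range n, shiftedWalk n z t = y at *
    rw [← sq_abs y]
    split_ifs with hy <;> nlinarith [abs_nonneg y]

open Classical in
-- The walk and the validation sum use disjoint bits, so the moments factor. Flipping all validation
-- bits reverses the sum and keeps the walk, which yields the opposite sign half of the time.
theorem le_bitMean_overfitEvent (n : ℕ) (hn : 3000 ≤ n) :
    1 / 1000 ≤ bitMean (Finset.Icc 1 (2 * n)) (fun z => if OverfitEvent n z then 1 else 0) := by
  have hn' : (0 : ℝ) < n := by exact_mod_cast (by omega : 0 < n)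
  set s := Finset.Icc 1 (2 * n)
  have hsub : Finset.Icc 1 n ⊆ s := Finset.Icc_subset_Icc_right (by omega)
  set G : (ℕ → Bool) → ℝ := fun z =>
    if 39 / 200 ≤ |1 / (n : ℝ) * ∑ t ∈ Finset.range n, shiftedWalk n z t| then 1 else 0 with hGdef
  have hwalk (T : Finset ℕ) (hT : T ⊆ Finset.Icc 1 n) (z : ℕ → Bool) :
      ∑ t ∈ Finset.range n, shiftedWalk n (flipOn T z) t =
        ∑ t ∈ Finset.range n, shiftedWalk n z t := by
    refine Finset.sum_congr rfl fun t _ => shiftedWalk_flipOn (fun i hi h => ?_) z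
    have := hT h
    simp only [Finset.mem_Icc] at hi this
    omega
  have hG : ∀ i ∈ Finset.Icc 1 n, ∀ z, G (flipOn {i} z) = G z := fun i hi z => by
    simp only [hGdef, hwalk {i} (by simpa using hi)]
  have hGm := le_bitMean_mean_walk_large n hn
  have h2 := bitMean_mul_sum_sq n hsub hG
  have h4 := bitMean_mul_sum_pow_four n hsub hG
  rw [bitMean_eq_flipOn_average hsub]
  -- With `w = V² / n - 1 / 400`, where `V` is the validation sum, the indicator of `w ≥ 0` is at
  -- least `w (6 - w) / 9`, as the parabola peaks at `9`. The flip average contributes the other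
  -- factor `1 / 2`.
  refine le_trans ?_ (bitMean_mono (F := fun z =>
    1 / 18 * ((6 + 1 / 200) / n * (G z * (∑ i ∈ Finset.Icc 1 n, bitSign (z i)) ^ 2) -
      1 / (n : ℝ) ^ 2 * (G z * (∑ i ∈ Finset.Icc 1 n, bitSign (z i)) ^ 4) -
      (6 / 400 + 1 / 160000) * G z)) fun z => ?_)
  · rw [bitMean_const_mul, bitMean_sub, bitMean_sub, bitMean_const_mul, bitMean_const_mul,
      bitMean_const_mul, h2, h4]
    change 117 / 10000 ≤ bitMean s G at hGm
    have e : (6 + 1 / 200) / (n : ℝ) * (n * bitMean s G) -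
        1 / (n : ℝ) ^ 2 * ((3 * n ^ 2 - 2 * n) * bitMean s G) =
        (3 + 1 / 200) * bitMean s G + 2 / n * bitMean s G := by
      field_simp
      ring
    rw [e]
    have : 0 ≤ 2 / (n : ℝ) * bitMean s G := by positivity
    linarith
  · have hV : ∑ i ∈ Finset.Icc 1 n, bitSign (flipOn (Finset.Icc 1 n) z i) =
        -∑ i ∈ Finset.Icc 1 n, bitSign (z i) := by
      rw [← Finset.sum_neg_distrib]
      exact Finset.sum_congr rfl fun i hi => by rw [flipOn_of_mem hi, bitSign_not]
    have hind (w : ℕ → Bool) : (0 : ℝ) ≤ if OverfitEvent n w then 1 else 0 := by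
      split_ifs <;> norm_num
    have h1 := hind z
    have h2 := hind (flipOn (Finset.Icc 1 n) z)
    by_cases hy : 39 / 200 ≤ |1 / (n : ℝ) * ∑ t ∈ Finset.range n, shiftedWalk n z t|
    swap
    · simp only [hGdef, if_neg hy, zero_mul, mul_zero, sub_zero]
      linarith
    have hX (V : ℝ) : 1 / 18 * ((6 + 1 / 200) / n * (1 * V ^ 2) - 1 / (n : ℝ) ^ 2 * (1 * V ^ 4) -
        (6 / 400 + 1 / 160000) * 1) = 1 / 18 * ((V ^ 2 / n - 1 / 400) *
          (6 - (V ^ 2 / n - 1 / 400))) := by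
      field_simp
      ring
    simp only [hGdef, if_pos hy]
    rw [hX]
    by_cases hVn : √(n : ℝ) / 20 ≤ |∑ i ∈ Finset.Icc 1 n, bitSign (z i)|
    · have hV0 : ∑ i ∈ Finset.Icc 1 n, bitSign (z i) ≠ 0 := by
        intro h
        rw [h, abs_zero] at hVn
        have := Real.sqrt_pos.2 hn'
        linarith
      have hor : OverfitEvent n z ∨ OverfitEvent n (flipOn (Finset.Icc 1 n) z) := by
        have hy0 : 1 / (n : ℝ) * ∑ t ∈ Finset.range n, shiftedWalk n z t ≠ 0 := by
          intro h
          rw [h] at hy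
          norm_num at hy
        simp only [OverfitEvent, hV, hwalk _ subset_rfl, abs_neg, mul_neg]
        rcases lt_or_gt_of_ne (mul_ne_zero hy0 hV0) with h | h
        · exact Or.inl ⟨hy, hVn, h⟩
        · exact Or.inr ⟨hy, hVn, by linarith⟩
      have hone : (1 : ℝ) ≤ (if OverfitEvent n z then 1 else 0) +
          if OverfitEvent n (flipOn (Finset.Icc 1 n) z) then 1 else 0 := by
        rcases hor with h | h
        · rw [if_pos h]
          linarith
        · rw [if_pos h]
          linarith
      nlinarith [sq_nonneg ((∑ i ∈ Finset.Icc 1 n, bitSign (z i)) ^ 2 / n - 1 / 400 - 3)]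
    · push Not at hVn
      have h3 : (∑ i ∈ Finset.Icc 1 n, bitSign (z i)) ^ 2 / n ≤ 1 / 400 := by
        rw [div_le_iff₀ hn', ← sq_abs]
        have := Real.sq_sqrt hn'.le
        nlinarith [abs_nonneg (∑ i ∈ Finset.Icc 1 n, bitSign (z i))]
      have h0 : 0 ≤ (∑ i ∈ Finset.Icc 1 n, bitSign (z i)) ^ 2 / n := by positivity
      nlinarith

/-! ### From counting to independent samples -/

/-- The law of a fair bit. -/
noncomputable def fairBit : Measure Bool := (PMF.uniformOfFintype Bool).toMeasure

instance : IsProbabilityMeasure fairBit := by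
  unfold fairBit
  infer_instance

theorem fairBit_singleton (b : Bool) : fairBit {b} = 2⁻¹ := by
  simp [fairBit]

theorem integral_fairBit (f : Bool → ℝ) : ∫ b, f b ∂fairBit = (f true + f false) / 2 := by
  rw [fairBit, PMF.integral_eq_sum]
  simp
  ring

/-- Both bits have positive mass, so almost sure subgradient conditions hold for every bit. -/
theorem ae_fairBit_iff {p : Bool → Prop} : (∀ᵐ b ∂fairBit, p b) ↔ ∀ b, p b := by
  refine ⟨fun h b => ?_, ae_of_all _⟩
  by_contra hb
  have h1 : fairBit {b} = 0 := measure_mono_null (by simpa using hb) (ae_iff.1 h)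
  simp [fairBit_singleton] at h1

open Classical in
/-- Events about independent fair bits have at least the probability given by counting. -/
theorem withProbAtLeast_of_iIndepFun {Ω : Type*} [MeasurableSpace Ω] {μ : Measure Ω}
    [IsProbabilityMeasure μ] {s : Finset ℕ} {S : ℕ → Ω → Bool}
    (hlaw : ∀ i ∈ s, HasLaw (S i) fairBit μ) (hindep : iIndepFun (fun i : s => S i) μ)
    (Q : (ℕ → Bool) → Prop) {p : ℝ} (hp : p ≤ bitMean s fun z => if Q z then 1 else 0) :
    WithProbAtLeast μ p (fun ω => Q (extendBits s fun i => S i ω)) := by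
  have hm (i : s) : AEMeasurable (S i) μ := (hlaw i i.2).aemeasurable
  set X : Ω → s → Bool := fun ω i => S i ω
  have hX : AEMeasurable X μ := aemeasurable_pi_iff.2 hm
  have hmap : μ.map X = Measure.pi fun _ : s => fairBit := by
    rw [(iIndepFun_iff_map_fun_eq_pi_map hm).1 hindep]
    exact congrArg Measure.pi (funext fun i => (hlaw i i.2).map_eq)
  set B : Set (s → Bool) := {x | Q (extendBits s x)} with hB
  have hBm : MeasurableSet B := B.toFinite.measurableSet
  -- The samples are only almost everywhere measurable, so the event is replaced by a measurable
  -- subset of the same measure.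
  obtain ⟨A, hAsub, hAm, hAeq⟩ :=
    (hX.nullMeasurableSet_preimage hBm).exists_measurable_subset_ae_eq
  refine ⟨A, hAm, hp.trans (le_of_eq ?_), fun ω hω => hAsub hω⟩
  rw [measureReal_congr hAeq, ← map_measureReal_apply_of_aemeasurable hX hBm, hmap]
  have hsum : (Measure.pi fun _ : s => fairBit).real B =
      ∑ x ∈ B.toFinite.toFinset, (Measure.pi fun _ : s => fairBit).real {x} := by
    rw [sum_measureReal_singleton, Set.Finite.coe_toFinset]
  rw [hsum]
  have hx (x : s → Bool) : (Measure.pi fun _ : s => fairBit).real {x} = (2 ^ s.card)⁻¹ := by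
    rw [measureReal_def, Measure.pi_singleton]
    simp [fairBit_singleton]
  simp only [hx]
  rw [bitMean, Fintype.expect_eq_sum_div_card]
  simp [hB, div_eq_mul_inv]

/-! ### The one-dimensional sign problem -/

theorem smul_projBall_univ {d : ℕ} {R : ℝ} (hR : 0 < R) (v : EuclideanSpace ℝ (Fin d)) :
    projBall Set.univ R (R • v) = R • projBall Set.univ 1 v := by
  symm
  refine eq_projBall_of_mem isClosed_univ convex_univ (Set.mem_univ _) hR.le ?_
  obtain ⟨⟨-, h1⟩, h2⟩ := projBall_mem (X := Set.univ) isClosed_univ (Set.mem_univ _) zero_le_one v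
  refine ⟨⟨Set.mem_univ _, ?_⟩, fun w _ hw => ?_⟩
  · rw [norm_smul, Real.norm_of_nonneg hR.le]
    nlinarith
  · have h3 := h2 (R⁻¹ • w) (Set.mem_univ _) (by
      rw [norm_smul, Real.norm_of_nonneg (by positivity), inv_mul_le_iff₀ hR, mul_one]
      exact hw)
    have e : w - R • v = R • (R⁻¹ • w - v) := by
      rw [smul_sub, smul_inv_smul₀ hR.ne']
    rw [← smul_sub, e, norm_smul, norm_smul]
    exact mul_le_mul_of_nonneg_left h3 (norm_nonneg _)

theorem norm_euclideanSpace_fin_one (x : EuclideanSpace ℝ (Fin 1)) : ‖x‖ = |x 0| := by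
  simp [EuclideanSpace.norm_eq, Real.sqrt_sq_eq_abs]

theorem projBall_univ_one_apply (v : EuclideanSpace ℝ (Fin 1)) :
    projBall Set.univ 1 v 0 = clampUnit (v 0) := by
  have h : (!₂[clampUnit (v 0)] : EuclideanSpace ℝ (Fin 1)) ∈ nearestPoints Set.univ 1 v := by
    refine ⟨⟨Set.mem_univ _, ?_⟩, fun w _ hw => ?_⟩
    · simpa [norm_euclideanSpace_fin_one] using abs_clampUnit_le (v 0)
    · rw [norm_euclideanSpace_fin_one] at hw
      have h1 := abs_clampUnit_sub_self_le hw (v 0)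
      simpa [norm_euclideanSpace_fin_one] using h1
  rw [← eq_projBall_of_mem isClosed_univ convex_univ (Set.mem_univ _) zero_le_one h]
  simp

/-- The one-dimensional problem with loss `(1 - ε) s x + ε |x|` for a random sign `s`. -/
noncomputable def signProblem (ε : ℝ) (h0 : 0 ≤ ε) : StochConvexProblem 1 Bool where
  domain := Set.univ
  isClosed_domain := isClosed_univ
  convex_domain := convex_univ
  zero_mem := Set.mem_univ _
  law := fairBit
  isProb := inferInstance
  loss x b := (1 - ε) * bitSign b * x 0 + ε * |x 0|
  convexOn_loss b := by
    refine ⟨convex_univ, fun x _ y _ a c ha hc _ => ?_⟩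
    have h1 : |a * x 0 + c * y 0| ≤ a * |x 0| + c * |y 0| := by
      refine (abs_add_le _ _).trans (le_of_eq ?_)
      rw [abs_mul, abs_mul, abs_of_nonneg ha, abs_of_nonneg hc]
    simp only [PiLp.add_apply, PiLp.smul_apply, smul_eq_mul]
    nlinarith [mul_le_mul_of_nonneg_left h1 h0]
  integrable_loss _ _ := Integrable.of_finite
  bddBelow_risk := by
    refine ⟨0, ?_⟩
    rintro _ ⟨x, -, rfl⟩
    simp only [integral_fairBit]
    have : 0 ≤ ε * |x 0| := by positivity
    simp [bitSign]
    linarith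

namespace signProblem

variable {ε : ℝ} {h0 : 0 ≤ ε}

theorem risk_eq (x : EuclideanSpace ℝ (Fin 1)) : (signProblem ε h0).risk x = ε * |x 0| := by
  change ∫ b, ((1 - ε) * bitSign b * x 0 + ε * |x 0|) ∂fairBit = _
  rw [integral_fairBit]
  simp only [bitSign, if_true, Bool.false_eq_true, if_false]
  ring

theorem isMinOn_risk : IsMinOn (signProblem ε h0).risk (signProblem ε h0).domain 0 := by
  intro x _
  simp only [Set.mem_ofPred_eq, risk_eq, PiLp.zero_apply, abs_zero, mul_zero]
  positivity

theorem optRisk_eq : (signProblem ε h0).optRisk = 0 := by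
  have h : IsLeast ((signProblem ε h0).risk '' (signProblem ε h0).domain) 0 := by
    refine ⟨⟨0, Set.mem_univ _, by simp [risk_eq]⟩, ?_⟩
    rintro _ ⟨x, -, rfl⟩
    rw [risk_eq]
    positivity
  exact h.csInf_eq

theorem isLipschitz (h1 : ε ≤ 1) : (signProblem ε h0).IsLipschitz 1 := by
  refine ae_of_all _ fun b x _ y _ => ?_
  change |(1 - ε) * bitSign b * x 0 + ε * |x 0| - ((1 - ε) * bitSign b * y 0 + ε * |y 0|)| ≤ _
  have e : (1 - ε) * bitSign b * x 0 + ε * |x 0| - ((1 - ε) * bitSign b * y 0 + ε * |y 0|) =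
      (1 - ε) * bitSign b * (x 0 - y 0) + ε * (|x 0| - |y 0|) := by ring
  rw [e, norm_euclideanSpace_fin_one]
  refine (abs_add_le _ _).trans ?_
  rw [abs_mul, abs_mul, abs_mul, abs_bitSign, abs_of_nonneg h0, abs_of_nonneg (sub_nonneg.2 h1)]
  have := abs_abs_sub_abs_le (x 0) (y 0)
  simp only [PiLp.sub_apply]
  nlinarith

variable {g : EuclideanSpace ℝ (Fin 1) → Bool → EuclideanSpace ℝ (Fin 1)}

theorem subgradient_iff {x : EuclideanSpace ℝ (Fin 1)} {b : Bool} {v : EuclideanSpace ℝ (Fin 1)} :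
    (signProblem ε h0).IsSubgradient x b v ↔
      ∀ y : ℝ, (v 0 - (1 - ε) * bitSign b) * (y - x 0) ≤ ε * (|y| - |x 0|) := by
  have key (y : EuclideanSpace ℝ (Fin 1)) :
      (signProblem ε h0).loss x b + inner ℝ v (y - x) ≤ (signProblem ε h0).loss y b ↔
        (v 0 - (1 - ε) * bitSign b) * (y 0 - x 0) ≤ ε * (|y 0| - |x 0|) := by
    simp only [signProblem, PiLp.inner_apply, Fin.sum_univ_one, PiLp.sub_apply,
      RCLike.inner_apply, conj_trivial]
    constructor <;> intro h <;> linarith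
  constructor
  · intro h y
    simpa using (key !₂[y]).1 (h _ (Set.mem_univ _))
  · intro h y _
    exact (key y).2 (h _)

/-- Testing at `x ± 1` suffices, and covers the kink at `0`, where the oracle is free. -/
theorem abs_subgradient_sub_le (hg : (signProblem ε h0).IsSubgradientOracle g)
    (x : EuclideanSpace ℝ (Fin 1)) (b : Bool) : |g x b 0 - (1 - ε) * bitSign b| ≤ ε := by
  have h := subgradient_iff.1 (ae_fairBit_iff.1 hg b x (Set.mem_univ _))
  have h1 := h (x 0 + 1)
  have h2 := h (x 0 - 1)
  have h3 := abs_abs_sub_abs_le (x 0 + 1) (x 0)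
  have h4 := abs_abs_sub_abs_le (x 0 - 1) (x 0)
  simp only [add_sub_cancel_left, abs_one, sub_sub_cancel_left, abs_neg] at h1 h2 h3 h4
  rw [abs_le] at h3 h4 ⊢
  constructor <;> nlinarith

theorem subgradient_of_ne (hg : (signProblem ε h0).IsSubgradientOracle g)
    {x : EuclideanSpace ℝ (Fin 1)} (hx : x 0 ≠ 0) (b : Bool) :
    g x b 0 = (1 - ε) * bitSign b + ε * SignType.sign (x 0) := by
  have h := subgradient_iff.1 (ae_fairBit_iff.1 hg b x (Set.mem_univ _))
  have h1 := h 0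
  have h2 := h (2 * x 0)
  rw [abs_mul, abs_two] at h2
  rw [abs_zero] at h1
  rcases lt_or_gt_of_ne hx with hx | hx
  · rw [abs_of_neg hx] at h1 h2
    rw [sign_neg hx]
    rw [SignType.coe_neg_one]
    refine mul_right_cancel₀ hx.ne (le_antisymm ?_ ?_) <;> linarith
  · rw [abs_of_pos hx] at h1 h2
    rw [sign_pos hx]
    rw [SignType.coe_one]
    refine mul_right_cancel₀ hx.ne' (le_antisymm ?_ ?_) <;> linarith

/-- At the kink the point itself is unchanged by scaling, so even an arbitrary choice there is scale
invariant. -/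
theorem subgradient_smul (hg : (signProblem ε h0).IsSubgradientOracle g) {R : ℝ} (hR : 0 < R)
    (x : EuclideanSpace ℝ (Fin 1)) (b : Bool) : g (R • x) b = g x b := by
  by_cases hx : x 0 = 0
  · have : R • x = x := by
      ext i
      fin_cases i
      simp [hx]
    rw [this]
  · have hRx : (R • x) 0 ≠ 0 := by simp [hR.ne', hx]
    ext i
    fin_cases i
    change g (R • x) b 0 = g x b 0
    rw [subgradient_of_ne hg hx, subgradient_of_ne hg hRx, PiLp.smul_apply, smul_eq_mul, sign_mul,
      sign_pos hR, one_mul]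

/-! ### Adaptive SGD against the clamped walk -/

/-- Adaptive SGD is equivariant under rescaling of the learning rate. -/
theorem adaSGD_eq_smul (hg : (signProblem ε h0).IsSubgradientOracle g) {R : ℝ} (hR : 0 < R) (n : ℕ)
    (z : ℕ → Bool) :
    (signProblem ε h0).adaSGD g R n z = R • (signProblem ε h0).adaSGD g 1 n z := by
  have hstate (t : ℕ) : (signProblem ε h0).adaSGDState g R z t =
      (R • ((signProblem ε h0).adaSGDState g 1 z t).1, ((signProblem ε h0).adaSGDState g 1 z t).2) := by
    induction t with
    | zero => simp [StochConvexProblem.adaSGDState]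
    | succ t ih =>
      simp only [StochConvexProblem.adaSGDState, ih, subgradient_smul hg hR]
      rw [show (signProblem ε h0).domain = Set.univ from rfl, ← smul_projBall_univ hR, smul_sub,
        smul_smul, mul_one_div]
  simp only [StochConvexProblem.adaSGD, StochConvexProblem.adaSGDIter, hstate]
  rw [← Finset.smul_sum, smul_comm]

/-- Up to an error of order `ε √t`, adaptive SGD with learning rate `1` is the clamped walk. -/
theorem abs_adaSGDState_sub_clampWalk_le (h4 : ε ≤ 1 / 4)
    (hg : (signProblem ε h0).IsSubgradientOracle g) (z : ℕ → Bool) (t : ℕ) :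
    |((signProblem ε h0).adaSGDState g 1 z t).1 0 - clampWalk z t| ≤
        2 * (2 * ε / (1 - 2 * ε)) * √(t : ℝ) ∧
      (1 - 2 * ε) ^ 2 * t ≤ ((signProblem ε h0).adaSGDState g 1 z t).2 ∧
      ((signProblem ε h0).adaSGDState g 1 z t).2 ≤ t := by
  induction t with
  | zero => simp [StochConvexProblem.adaSGDState, clampWalk]
  | succ t ih =>
    simp only [StochConvexProblem.adaSGDState, clampWalk]
    obtain ⟨ih1, ih2, ih3⟩ := ih
    set u := ((signProblem ε h0).adaSGDState g 1 z t).1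
    set q := ((signProblem ε h0).adaSGDState g 1 z t).2
    set b := z (t + 1)
    have hgb := abs_le.1 (abs_subgradient_sub_le hg u b)
    rw [norm_euclideanSpace_fin_one, sq_abs]
    set γ := g u b 0 with hγ
    have hγ2 : (1 - 2 * ε) ^ 2 ≤ γ ^ 2 ∧ γ ^ 2 ≤ 1 := by
      cases hb : b <;> simp [hb, bitSign] at hgb <;> constructor <;> nlinarith
    have hlo : (1 - 2 * ε) ^ 2 * ((t : ℝ) + 1) ≤ q + γ ^ 2 := by linarith [hγ2.1]
    have hhi : q + γ ^ 2 ≤ (t : ℝ) + 1 := by linarith [hγ2.2]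
    push_cast
    refine ⟨?_, hlo, hhi⟩
    rw [show (signProblem ε h0).domain = Set.univ from rfl, projBall_univ_one_apply]
    refine (abs_clampUnit_sub_le _ _).trans ?_
    have hr : 0 < √((t : ℝ) + 1) := Real.sqrt_pos.2 (by positivity)
    have hκ : 0 < 1 - 2 * ε := by linarith
    have hG1 : (1 - 2 * ε) * √((t : ℝ) + 1) ≤ √(q + γ ^ 2) := by
      apply Real.le_sqrt_of_sq_le
      rw [mul_pow, Real.sq_sqrt (by positivity)]
      exact hlo
    have hG2 : √(q + γ ^ 2) ≤ √((t : ℝ) + 1) := Real.sqrt_le_sqrt hhi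
    have hGpos : 0 < √(q + γ ^ 2) := lt_of_lt_of_le (by positivity) hG1
    have hstep : |γ / √(q + γ ^ 2) - bitSign b / √((t : ℝ) + 1)| ≤
        2 * ε / (1 - 2 * ε) / √((t : ℝ) + 1) := by
      have hpos : 1 - 2 * ε ≤ γ * bitSign b ∧ γ * bitSign b ≤ 1 := by
        cases hb : b <;> simp [hb, bitSign] at hgb ⊢ <;> constructor <;> linarith
      -- Multiplying by the sign reduces to a positive gradient in `[1 - 2ε, 1]`.
      have e : |γ / √(q + γ ^ 2) - bitSign b / √((t : ℝ) + 1)| =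
          |γ * bitSign b / √(q + γ ^ 2) - 1 / √((t : ℝ) + 1)| := by
        refine (mul_one _).symm.trans ?_
        rw [← abs_bitSign b, ← abs_mul, abs_bitSign]
        congr 1
        linear_combination (-1 / √((t : ℝ) + 1)) * bitSign_sq b
      rw [e, abs_le]
      have hinv1 : 1 / √((t : ℝ) + 1) ≤ 1 / √(q + γ ^ 2) := one_div_le_one_div_of_le hGpos hG2
      have hinv2 : 1 / √(q + γ ^ 2) ≤ 1 / ((1 - 2 * ε) * √((t : ℝ) + 1)) :=
        one_div_le_one_div_of_le (by positivity) hG1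
      have e2 : 1 / ((1 - 2 * ε) * √((t : ℝ) + 1)) =
          1 / √((t : ℝ) + 1) + 2 * ε / (1 - 2 * ε) / √((t : ℝ) + 1) := by
        field_simp
        ring
      have e3 : γ * bitSign b / √(q + γ ^ 2) = γ * bitSign b * (1 / √(q + γ ^ 2)) := by ring
      have hIpos : 0 < 1 / √(q + γ ^ 2) := by positivity
      have hrpos : 0 < 1 / √((t : ℝ) + 1) := by positivity
      constructor
      · have h5 : 2 * ε * (1 / √((t : ℝ) + 1)) ≤ 2 * ε / (1 - 2 * ε) / √((t : ℝ) + 1) := by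
          rw [div_eq_mul_one_div (2 * ε / (1 - 2 * ε))]
          refine mul_le_mul_of_nonneg_right ?_ hrpos.le
          rw [le_div_iff₀ hκ]
          nlinarith
        rw [e3]
        nlinarith [mul_le_mul hpos.1 hinv1 hrpos.le (hκ.le.trans hpos.1)]
      · rw [e3]
        nlinarith [mul_le_mul_of_nonneg_right hpos.2 hIpos.le]
    have hsum : |u 0 - clampWalk z t| + |γ / √(q + γ ^ 2) - bitSign b / √((t : ℝ) + 1)| ≤
        2 * (2 * ε / (1 - 2 * ε)) * √((t : ℝ) + 1) := by
      -- Clamping is nonexpansive, so step errors add; this inequality sums the `1 / √(t + 1)` to a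
      -- multiple of the square root.
      have h6 : 2 * √(t : ℝ) + 1 / √((t : ℝ) + 1) ≤ 2 * √((t : ℝ) + 1) := by
        have h7 := Real.sq_sqrt (Nat.cast_nonneg (α := ℝ) t)
        have h8 := Real.sq_sqrt (by positivity : 0 ≤ (t : ℝ) + 1)
        rw [← le_sub_iff_add_le', div_le_iff₀ hr]
        nlinarith [sq_nonneg (√((t : ℝ) + 1) - √(t : ℝ))]
      have h9 : 0 ≤ 2 * ε / (1 - 2 * ε) := by positivity
      have h10 := mul_le_mul_of_nonneg_left h6 h9
      rw [mul_add, mul_one_div] at h10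
      linarith
    refine le_trans ?_ hsum
    have e4 : (u - (1 / √(q + γ ^ 2)) • g u b) 0 - (clampWalk z t - bitSign b / √((t : ℝ) + 1)) =
        (u 0 - clampWalk z t) - (γ / √(q + γ ^ 2) - bitSign b / √((t : ℝ) + 1)) := by
      simp only [PiLp.sub_apply, PiLp.smul_apply, smul_eq_mul, ← hγ]
      ring
    rw [e4]
    exact abs_sub _ _

end signProblem

theorem sum_range_sqrt_le (n : ℕ) :
    ∑ t ∈ Finset.range n, √(t : ℝ) ≤ 2 / 3 * (n * √(n : ℝ)) := by
  induction n with
  | zero => simp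
  | succ n ih =>
    rw [Finset.sum_range_succ]
    push_cast
    have h0 : (0 : ℝ) ≤ n := Nat.cast_nonneg n
    have h1 := Real.sq_sqrt h0
    have h2 := Real.sq_sqrt (by positivity : 0 ≤ (n : ℝ) + 1)
    have h3 := Real.sqrt_le_sqrt (by linarith : (n : ℝ) ≤ n + 1)
    have h4 := Real.sqrt_nonneg (n : ℝ)
    generalize √(n : ℝ) = p at *
    generalize √((n : ℝ) + 1) = q at *
    rw [← h1] at ih
    rw [← h2]
    have h5 : (q - p) * (q + p) = 1 := by nlinarith
    have h6 : 0 ≤ (q - p) ^ 2 * (2 * q + p) := by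
      have : 0 ≤ q := h4.trans h3
      positivity
    have h7 : 3 * p = 3 * p * ((q - p) * (q + p)) := by rw [h5, mul_one]
    nlinarith

namespace signProblem

variable {ε : ℝ} {h0 : 0 ≤ ε} {g : EuclideanSpace ℝ (Fin 1) → Bool → EuclideanSpace ℝ (Fin 1)}

theorem abs_adaSGD_sub_mean_clampWalk_le (h4 : ε ≤ 1 / 4)
    (hg : (signProblem ε h0).IsSubgradientOracle g) (z : ℕ → Bool) {n : ℕ} (hn : 0 < n) :
    |(signProblem ε h0).adaSGD g 1 n z 0 - 1 / (n : ℝ) * ∑ t ∈ Finset.range n, clampWalk z t| ≤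
      4 / 3 * (2 * ε / (1 - 2 * ε)) * √(n : ℝ) := by
  have hn' : (0 : ℝ) < n := by exact_mod_cast hn
  have e : (signProblem ε h0).adaSGD g 1 n z 0 =
      1 / (n : ℝ) * ∑ t ∈ Finset.range n, ((signProblem ε h0).adaSGDState g 1 z t).1 0 := by
    rw [StochConvexProblem.adaSGD, PiLp.smul_apply, smul_eq_mul, Finset.range_eq_Ico,
      Finset.sum_Ico_eq_sum_range, ← Finset.Ico_add_one_right_eq_Icc, Finset.sum_Ico_eq_sum_range]
    simp [StochConvexProblem.adaSGDIter]
  rw [e, ← mul_sub, ← Finset.sum_sub_distrib, abs_mul, abs_of_pos (by positivity),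
    one_div_mul_eq_div, div_le_iff₀ hn']
  refine (Finset.abs_sum_le_sum_abs _ _).trans ?_
  refine (Finset.sum_le_sum fun t _ =>
    (abs_adaSGDState_sub_clampWalk_le h4 hg z t).1).trans ?_
  rw [← Finset.mul_sum]
  have h1 : 0 ≤ 1 - 2 * ε := by linarith
  have h2 : 0 ≤ 2 * (2 * ε / (1 - 2 * ε)) := by positivity
  refine (mul_le_mul_of_nonneg_left (sum_range_sqrt_le n) h2).trans (le_of_eq ?_)
  ring

theorem empRisk_eq {n : ℕ} (hn : 0 < n) (z : ℕ → Bool) (x : EuclideanSpace ℝ (Fin 1)) :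
    (signProblem ε h0).empRisk n z x =
      (1 - ε) / n * (x 0 * ∑ i ∈ Finset.Icc 1 n, bitSign (z i)) + ε * |x 0| := by
  have hn' : (n : ℝ) ≠ 0 := by exact_mod_cast hn.ne'
  simp only [StochConvexProblem.empRisk, signProblem, Finset.sum_add_distrib, Finset.sum_const,
    Nat.card_Icc, ← Finset.sum_mul, ← Finset.mul_sum, nsmul_eq_mul]
  field_simp
  simp [mul_comm]

theorem empRisk_smul {n : ℕ} (hn : 0 < n) (z : ℕ → Bool) {R : ℝ} (hR : 0 ≤ R)
    (x : EuclideanSpace ℝ (Fin 1)) :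
    (signProblem ε h0).empRisk n z (R • x) = R * (signProblem ε h0).empRisk n z x := by
  rw [empRisk_eq hn, empRisk_eq hn, PiLp.smul_apply, smul_eq_mul, abs_mul, abs_of_nonneg hR]
  ring

/-- On the overfitting event, the output of adaptive SGD with learning rate `1` is far from the
origin and has negative validation loss. -/
theorem adaSGD_of_overfit {n : ℕ} (hn : 3000 ≤ n) (hε : ε * (28 * √(n : ℝ)) = 1)
    (hg : (signProblem ε h0).IsSubgradientOracle g) {z : ℕ → Bool} (hz : OverfitEvent n z) :
    28 / 288 ≤ |(signProblem ε h0).adaSGD g 1 n (fun t => z (n + t)) 0| ∧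
      (signProblem ε h0).empRisk n z ((signProblem ε h0).adaSGD g 1 n fun t => z (n + t)) < 0 := by
  obtain ⟨h1, h2, h3⟩ := hz
  have hn0 : 0 < n := by omega
  have hn' : (3000 : ℝ) ≤ n := by exact_mod_cast hn
  have hsq : 54 ≤ √(n : ℝ) := Real.le_sqrt_of_sq_le (by linarith)
  have hε1 : ε ≤ 1 / 1512 := by nlinarith
  have hd := abs_adaSGD_sub_mean_clampWalk_le (by linarith) hg (fun t => z (n + t)) hn0
  -- As `ε √n = 1 / 28`, the error is `(2 / 21) / (1 - 2ε)`, and `39 / 200 - 96 / 1000` still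
  -- exceeds `28 / 288`.
  have hδ : 4 / 3 * (2 * ε / (1 - 2 * ε)) * √(n : ℝ) ≤ 96 / 1000 := by
    have hκ : 0 < 1 - 2 * ε := by linarith
    have e : 4 / 3 * (2 * ε / (1 - 2 * ε)) * √(n : ℝ) = 2 / 21 / (1 - 2 * ε) := by
      field_simp
      linarith
    rw [e, div_le_iff₀ hκ]
    linarith
  replace hd := hd.trans hδ
  rw [empRisk_eq hn0]
  change 39 / 200 ≤ |1 / (n : ℝ) * ∑ t ∈ Finset.range n, clampWalk (fun i => z (n + i)) t| at h1
  change (1 / (n : ℝ) * ∑ t ∈ Finset.range n, clampWalk (fun i => z (n + i)) t) * _ < 0 at h3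
  generalize 1 / (n : ℝ) * ∑ t ∈ Finset.range n, clampWalk (fun i => z (n + i)) t = w at *
  generalize (signProblem ε h0).adaSGD g 1 n (fun t => z (n + t)) 0 = x at *
  generalize ∑ i ∈ Finset.Icc 1 n, bitSign (z i) = V at *
  rw [abs_le] at hd
  have hx : 28 / 288 ≤ |x| ∧ x * V < 0 := by
    rcases lt_or_ge w 0 with hw | hw
    · rw [abs_of_neg hw] at h1
      have hx0 : x < 0 := by linarith
      have hV : 0 < V := pos_of_mul_neg_right h3 hw.le
      exact ⟨by rw [abs_of_neg hx0]; linarith, mul_neg_of_neg_of_pos hx0 hV⟩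
    · rw [abs_of_nonneg hw] at h1
      have hx0 : 0 < x := by linarith
      have hV : V < 0 := neg_of_mul_neg_right h3 hw
      exact ⟨by rw [abs_of_pos hx0]; linarith, mul_neg_of_pos_of_neg hx0 hV⟩
  refine ⟨hx.1, ?_⟩
  have e : x * V = -(|x| * |V|) := by rw [← abs_mul, abs_of_neg hx.2, neg_neg]
  have hxpos : 0 < |x| := by linarith [hx.1]
  have hs : √(n : ℝ) * √(n : ℝ) = n := Real.mul_self_sqrt (by linarith)
  -- The margin of `1 / 20` over `1 / 28` absorbs the factor `1 - ε`.
  have h5 : ε < (1 - ε) / n * |V| := by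
    have h6 : ε = √(n : ℝ) / 28 / n := by
      rw [eq_div_iff (by linarith)]
      linear_combination √(n : ℝ) / 28 * hε - ε * hs
    rw [div_mul_eq_mul_div]
    nth_rw 1 [h6]
    refine div_lt_div_of_pos_right ?_ (by linarith)
    nlinarith
  rw [e]
  nlinarith

end signProblem

/-! ### Conclusion -/

theorem extendBits_of_mem {s : Finset ℕ} {i : ℕ} (hi : i ∈ s) (z : ℕ → Bool) :
    extendBits s (fun j => z j) i = z i := by
  simp [extendBits, hi]

theorem overfitEvent_congr {n : ℕ} {z z' : ℕ → Bool}
    (h : ∀ i ∈ Finset.Icc 1 (2 * n), z i = z' i) (hz : OverfitEvent n z) : OverfitEvent n z' := by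
  have h1 : ∑ t ∈ Finset.range n, shiftedWalk n z t = ∑ t ∈ Finset.range n, shiftedWalk n z' t := by
    refine Finset.sum_congr rfl fun t ht => clampWalk_congr fun i hi => h _ ?_
    simp only [Finset.mem_range, Finset.mem_Icc] at *
    omega
  have h2 : ∑ i ∈ Finset.Icc 1 n, bitSign (z i) = ∑ i ∈ Finset.Icc 1 n, bitSign (z' i) := by
    refine Finset.sum_congr rfl fun i hi => congrArg bitSign (h _ ?_)
    simp only [Finset.mem_Icc] at *
    omega
  rwa [OverfitEvent, h1, h2] at hz

theorem mainTheorem4 (n : ℕ) (hn : 3000 ≤ n) (K : ℕ) (η : Fin (K + 1) → ℝ) (hη : ∀ k, 0 < η k) :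
    ∃ (d : ℕ) (𝒮 : Type) (_ : MeasurableSpace 𝒮) (P : StochConvexProblem d 𝒮),
      P.IsLipschitz 1 ∧ IsMinOn P.risk P.domain 0 ∧
      ∀ g : EuclideanSpace ℝ (Fin d) → 𝒮 → EuclideanSpace ℝ (Fin d), P.IsSubgradientOracle g →
      ∀ (Ω : Type*) [MeasurableSpace Ω] (μ : Measure Ω) [IsProbabilityMeasure μ]
        (S : ℕ → Ω → 𝒮),
        (∀ i ∈ Finset.Icc 1 (2 * n), HasLaw (S i) P.law μ) →
        iIndepFun (fun i : Finset.Icc 1 (2 * n) => S i) μ →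
        WithProbAtLeast μ (1 / 1000) (fun ω =>
          ∀ k ∈ P.greedySelection n (fun i => S i ω)
              (fun k => P.adaSGD g (η k) n (fun t => S (n + t) ω)),
            1 / (288 * √(n : ℝ)) * (⨆ k, η k) ≤
              P.risk (P.adaSGD g (η k) n (fun t => S (n + t) ω)) - P.optRisk) := by
  have hn0 : 0 < n := by omega
  have hn' : (3000 : ℝ) ≤ n := by exact_mod_cast hn
  have hsq : 54 ≤ √(n : ℝ) := Real.le_sqrt_of_sq_le (by linarith)
  obtain ⟨ε, hε⟩ : ∃ ε : ℝ, ε * (28 * √(n : ℝ)) = 1 := ⟨_, inv_mul_cancel₀ (by positivity)⟩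
  have h0 : 0 ≤ ε := by nlinarith
  have h1 : ε ≤ 1 := by nlinarith
  refine ⟨1, Bool, inferInstance, signProblem ε h0, signProblem.isLipschitz h1,
    signProblem.isMinOn_risk, ?_⟩
  intro g hg Ω _ μ _ S hlaw hindep
  obtain ⟨A, hAm, hAp, hA⟩ := withProbAtLeast_of_iIndepFun hlaw hindep (OverfitEvent n)
    (le_bitMean_overfitEvent n hn)
  refine ⟨A, hAm, hAp, fun ω hω k hk => ?_⟩
  have hover : OverfitEvent n (fun i => S i ω) :=
    overfitEvent_congr (fun i hi => extendBits_of_mem hi fun j => S j ω) (hA ω hω)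
  obtain ⟨hx, hneg⟩ := signProblem.adaSGD_of_overfit hn hε hg hover
  -- All validation losses are `η` times one negative number, so a minimizer has the largest rate.
  have hmax : ⨆ k, η k ≤ η k := by
    refine ciSup_le fun j => ?_
    have h2 := hk j
    simp only [signProblem.adaSGD_eq_smul hg (hη _),
      signProblem.empRisk_smul hn0 _ (hη _).le] at h2
    exact (mul_le_mul_right_of_neg hneg).1 h2
  rw [signProblem.adaSGD_eq_smul hg (hη k), signProblem.risk_eq, signProblem.optRisk_eq, sub_zero,
    PiLp.smul_apply, smul_eq_mul, abs_mul, abs_of_pos (hη k)]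
  have e : 1 / (288 * √(n : ℝ)) = ε * (28 / 288) := by
    rw [div_eq_iff (by positivity)]
    linarith
  rw [e]
  calc ε * (28 / 288) * ⨆ k, η k ≤ ε * (28 / 288) * η k :=
        mul_le_mul_of_nonneg_left hmax (by positivity)
    _ = ε * (η k * (28 / 288)) := by ring
    _ ≤ _ := mul_le_mul_of_nonneg_left (mul_le_mul_of_nonneg_left hx (hη k).le) h0
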